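/- All graphs are finite and simple. Call a graph nontrivial if it has at least two vertices; its girth is the length of its shortest cycle, or $\infty$ if it has no cycle. A graph is well-covered if all of its inclusion-maximal independent sets of vertices have the same cardinality. The Cartesian product $G \,\square\, H$ has vertex set $V(G)\times V(H)$, with $(g_1,h_1)$ and $(g_2,h_2)$ adjacent if and only if either $g_1=g_2$ and $h_1h_2\in E(H)$, or $h_1=h_2$ and $g_1g_2\in E(G)$. Let $K_2$ be the complete graph on two vertices and $C_5$ the cycle on five vertices. Theorem. Let $G$ and $H$ be nontrivial connected graphs, both of girth at least $5$. Then $G \,\square\, H$ is well-covered if and only if $G \,\square\, H$ is isomorphic to $K_2 \,\square\, K_2$ or to $C_5 \,\square\, K_2$. -/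

import Mathlib

/-- A finite graph is well-covered if all its maximal (by inclusion) independent vertex sets have
the same cardinality. -/
def SimpleGraph.IsWellCovered {V : Type*} [Finite V] (G : SimpleGraph V) : Prop :=
  ∀ s t : Set V, Maximal G.IsIndepSet s → Maximal G.IsIndepSet t → s.ncard = t.ncard

/-!
The engine is a swap (`not_isWellCovered_of_swap`): if an independent set `I` avoids the
neighbourhoods of an induced path `q, p, r` and dominates all other neighbours of `q` and `r`, then in
a maximal independent set containing `I` and `p` the vertex `p` can be exchanged for `q` and `r`, so
the graph is not well-covered. All non-well-covered products arise from suitable choices of `I`.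

* A leaf of a factor whose neighbour is not a leaf yields a swap, so each factor of a well-covered
  product is `K₂` or has no leaves (`IsWellCovered.edge_or_leafless`).
* Two factors without leaves yield a swap along a path in one layer
  (`not_isWellCovered_boxProd_of_leafless`). Hence one factor is `K₂`.
* Let `G` be leafless with well-covered prism, and `q` a vertex of minimum degree. For a path
  `q, u, r` one tries to put the second neighbours of `u` behind `q` and `r` into the other layer;
  those obstructed by an edge between the two sides are dominated within the layer, by vertices chosen
  greedily, which is possible because there are no four-cycles. This succeeds unless every neighbour
  of `q` has a common neighbour with `r` (`IsWellCovered.exists_common_neighbor`). In that case one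
  vertex can dominate two obstructions, and if `q` has degree at least three the greedy choice
  succeeds after all (`not_isWellCovered_prism_of_three_le_degree`). If `q` has degree two, the
  property spreads to its neighbours, and `G` is a five-cycle
  (`IsWellCovered.nonempty_iso_cycleGraph_five`).

The prisms over `K₂` and `C₅` are well-covered by a finite check of the indicator functions of maximal
independent sets.
-/

namespace SimpleGraph

variable {V W : Type*} {G : SimpleGraph V} {H : SimpleGraph W}

/-! ### Maximal independent sets and the swap -/

theorem maximal_isIndepSet_iff {s : Set V} :
    Maximal G.IsIndepSet s ↔
      (∀ x ∈ s, ∀ y ∈ s, ¬ G.Adj x y) ∧ ∀ x, x ∉ s → ∃ y ∈ s, G.Adj x y := by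
  constructor
  · intro h
    refine ⟨fun x hx y hy hxy => h.1 hx hy hxy.ne hxy, fun x hx => ?_⟩
    by_contra! hcon
    refine hx (h.2 (y := insert x s) ?_ (Set.subset_insert _ _) (Set.mem_insert _ _))
    exact Set.pairwise_insert.2
      ⟨h.1, fun y hy _ => ⟨hcon y hy, fun hyx => hcon y hy hyx.symm⟩⟩
  · rintro ⟨h1, h2⟩
    refine ⟨fun x hx y hy _ => h1 x hx y hy, fun t ht hst x hx => ?_⟩
    by_contra hxs
    obtain ⟨y, hy, hxy⟩ := h2 x hxs
    exact ht hx (hst hy) hxy.ne hxy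

theorem IsWellCovered.of_iso [Finite V] [Finite W] (e : G ≃g H) (hH : H.IsWellCovered) :
    G.IsWellCovered := by
  have key : ∀ s : Set V, Maximal G.IsIndepSet s → Maximal H.IsIndepSet (e '' s) := by
    intro s hs
    rw [maximal_isIndepSet_iff] at hs ⊢
    refine ⟨?_, fun x hx => ?_⟩
    · rintro _ ⟨x, hx, rfl⟩ _ ⟨y, hy, rfl⟩
      rw [e.map_adj_iff]
      exact hs.1 x hx y hy
    · obtain ⟨x, rfl⟩ := e.surjective x
      obtain ⟨y, hy, hxy⟩ := hs.2 x fun h => hx ⟨x, h, rfl⟩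
      exact ⟨_, ⟨y, hy, rfl⟩, e.map_adj_iff.2 hxy⟩
  intro s t hs ht
  rw [← Set.ncard_image_of_injective s e.injective, ← Set.ncard_image_of_injective t e.injective]
  exact hH _ _ (key s hs) (key t ht)

/-- The swap: if `I` is independent, misses the neighbourhoods of the path `q, p, r`, and dominates
every neighbour of `q` and `r` other than `p`, then a maximal independent set containing `I` and
`p` becomes a larger independent set on replacing `p` by `q` and `r`. -/
theorem not_isWellCovered_of_swap [Finite V] (I : Set V) (p q r : V)
    (hpq : G.Adj p q) (hpr : G.Adj p r) (hqr : q ≠ r) (hqr' : ¬ G.Adj q r)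
    (hI : ∀ x ∈ I, ∀ y ∈ I, ¬ G.Adj x y)
    (hp : ∀ x ∈ I, ¬ G.Adj p x) (hq : ∀ x ∈ I, ¬ G.Adj q x) (hr : ∀ x ∈ I, ¬ G.Adj r x)
    (hNq : ∀ z, G.Adj q z → z ≠ p → ∃ x ∈ I, G.Adj x z)
    (hNr : ∀ z, G.Adj r z → z ≠ p → ∃ x ∈ I, G.Adj x z) :
    ¬ G.IsWellCovered := by
  intro hwc
  have ext : ∀ s : Set V, (∀ x ∈ s, ∀ y ∈ s, ¬ G.Adj x y) →
      ∃ M, s ⊆ M ∧ Maximal G.IsIndepSet M := fun s hs =>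
    (Set.toFinite {t : Set V | G.IsIndepSet t}).exists_le_maximal
      (fun x hx y hy _ => hs x hx y hy)
  obtain ⟨M, hM, hMmax⟩ := ext (insert p I) (by
    rintro x (rfl | hx) y (rfl | hy)
    · exact G.irrefl
    · exact hp y hy
    · exact fun h => hp x hx h.symm
    · exact hI x hx y hy)
  have hMi := (maximal_isIndepSet_iff.1 hMmax).1
  have hpM : p ∈ M := hM (Set.mem_insert _ _)
  have hdom : ∀ y ∈ M, y ≠ p → ¬ G.Adj q y ∧ ¬ G.Adj r y := by
    intro y hy hyp
    constructor
    · intro h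
      obtain ⟨x, hx, hxy⟩ := hNq y h hyp
      exact hMi x (hM (Set.mem_insert_of_mem _ hx)) y hy hxy
    · intro h
      obtain ⟨x, hx, hxy⟩ := hNr y h hyp
      exact hMi x (hM (Set.mem_insert_of_mem _ hx)) y hy hxy
  obtain ⟨M', hM', hM'max⟩ := ext (insert q (insert r (M \ {p}))) (by
    have h1 : ∀ y ∈ M \ {p}, ¬ G.Adj q y := fun y hy => (hdom y hy.1 hy.2).1
    have h2 : ∀ y ∈ M \ {p}, ¬ G.Adj r y := fun y hy => (hdom y hy.1 hy.2).2
    rintro x (rfl | rfl | hx) y (rfl | rfl | hy)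
    · exact G.irrefl
    · exact hqr'
    · exact h1 y hy
    · exact fun h => hqr' h.symm
    · exact G.irrefl
    · exact h2 y hy
    · exact fun h => h1 x hx h.symm
    · exact fun h => h2 x hx h.symm
    · exact hMi x hx.1 y hy.1)
  have hcard := hwc M M' hMmax hM'max
  have hrn : r ∉ M \ {p} := fun h => hMi p hpM r h.1 hpr
  have hqn : q ∉ insert r (M \ {p}) := by
    rintro (h | h)
    · exact hqr h
    · exact hMi p hpM q h.1 hpq
  have h3 := Set.ncard_le_ncard hM' (Set.toFinite _)
  rw [Set.ncard_insert_of_notMem hqn, Set.ncard_insert_of_notMem hrn] at h3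
  have h4 := Set.ncard_sdiff_singleton_add_one hpM
  omega

/-! ### Consequences of girth and connectedness -/

theorem not_triangle_of_le_egirth (h : 5 ≤ G.egirth) (a b c : V) (hab : G.Adj a b)
    (hbc : G.Adj b c) : ¬ G.Adj c a := by
  intro hca
  have := le_egirth.1 h a (.cons hab (.cons hbc (.cons hca .nil))) (by
    rw [Walk.cons_isCycle_iff]
    have := hab.ne; have := hbc.ne; have := hca.ne
    simp_all [Walk.isPath_def]
    grind)
  norm_num [Walk.length] at this

theorem not_four_cycle_of_le_egirth (h : 5 ≤ G.egirth) (a b c d : V) (hac : a ≠ c) (hbd : b ≠ d)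
    (hab : G.Adj a b) (hbc : G.Adj b c) (hcd : G.Adj c d) : ¬ G.Adj d a := by
  intro hda
  have := le_egirth.1 h a (.cons hab (.cons hbc (.cons hcd (.cons hda .nil)))) (by
    rw [Walk.cons_isCycle_iff]
    have := hab.ne; have := hbc.ne; have := hcd.ne; have := hda.ne
    simp_all [Walk.isPath_def]
    grind)
  norm_num [Walk.length] at this

theorem Connected.mem_of_closed (hG : G.Connected) (S : Set V) {x : V} (hx : x ∈ S)
    (hS : ∀ a ∈ S, ∀ b, G.Adj a b → b ∈ S) (y : V) : y ∈ S := by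
  obtain ⟨w⟩ := hG.preconnected x y
  induction w with
  | nil => exact hx
  | cons h _ ih => exact ih (hS _ hx _ h)

theorem Connected.nonempty_iso_completeGraph_two (hG : G.Connected) {u v : V} (huv : G.Adj u v)
    (hu : ∀ x, G.Adj u x → x = v) (hv : ∀ x, G.Adj v x → x = u) :
    Nonempty (G ≃g completeGraph (Fin 2)) := by
  have hall : ∀ a, a = u ∨ a = v := hG.mem_of_closed {a | a = u ∨ a = v} (x := u) (.inl rfl) (by
    simp only [Set.mem_ofPred_eq]
    rintro a (rfl | rfl) b hab
    exacts [.inr (hu b hab), .inl (hv b hab)])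
  have hf : Function.Bijective ![u, v] := by
    constructor
    · intro i j hij
      have := huv.ne
      fin_cases i <;> fin_cases j <;> first | rfl | (simp at hij; grind)
    · intro a
      rcases hall a with rfl | rfl
      exacts [⟨0, rfl⟩, ⟨1, rfl⟩]
  refine ⟨(RelIso.mk (Equiv.ofBijective _ hf) ?_ : completeGraph (Fin 2) ≃g G).symm⟩
  intro i j
  change G.Adj (![u, v] i) (![u, v] j) ↔ _
  fin_cases i <;> fin_cases j <;> simp [huv, huv.symm]

/-- Isomorphic factors give isomorphic Cartesian products. -/
def boxProdIso {V' W' : Type*} {G' : SimpleGraph V'} {H' : SimpleGraph W'}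
    (e : G ≃g G') (f : H ≃g H') : (G □ H) ≃g (G' □ H') where
  toEquiv := e.toEquiv.prodCongr f.toEquiv
  map_rel_iff' := by
    intro x y
    simp [boxProd_adj, e.map_adj_iff, f.map_adj_iff]

/-! ### The two well-covered products -/

/-- The prism over a cycle (for `n = 2`, an edge) is well-covered with independence number `m` if
the indicator functions `a`, `b` of the two layers of a maximal independent set always have total
weight `m`. -/
theorem isWellCovered_prism_of_indicator {n : ℕ} [NeZero n] {G : SimpleGraph (Fin n)} (m : ℕ)
    (hG : ∀ i j, G.Adj i j ↔ j = i + 1 ∨ i = j + 1)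
    (key : ∀ a b : Fin n → Bool, (∀ i, (a i && b i) = false) →
      (∀ i, (a i && a (i + 1)) = false) → (∀ i, (b i && b (i + 1)) = false) →
      (∀ i, (a i || b i || a (i + 1) || a (i - 1)) = true) →
      (∀ i, (b i || a i || b (i + 1) || b (i - 1)) = true) →
      ∑ i, ((a i).toNat + (b i).toNat) = m) :
    (G □ completeGraph (Fin 2)).IsWellCovered := by
  classical
  suffices h : ∀ s : Set (Fin n × Fin 2),
      Maximal (G □ completeGraph (Fin 2)).IsIndepSet s → s.ncard = m from
    fun s t hs ht => (h s hs).trans (h t ht).symm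
  intro s hs
  have hc : s.ncard = ∑ i, ((decide ((i, (0 : Fin 2)) ∈ s)).toNat +
      (decide ((i, (1 : Fin 2)) ∈ s)).toNat) := by
    have : s = ↑(Finset.univ.filter (· ∈ s)) := by simp
    rw [this, Set.ncard_coe_finset, Finset.card_filter, Fintype.sum_prod_type]
    refine Finset.sum_congr rfl fun i _ => ?_
    rw [Fin.sum_univ_two]
    by_cases h0 : (i, (0 : Fin 2)) ∈ s <;> by_cases h1 : (i, (1 : Fin 2)) ∈ s <;> simp [h0, h1]
  obtain ⟨h1, h2⟩ := maximal_isIndepSet_iff.1 hs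
  have hdom : ∀ i (j j' : Fin 2), (∀ l, l ≠ j → l = j') → (i, j) ∉ s →
      (i, j') ∈ s ∨ (i + 1, j) ∈ s ∨ (i - 1, j) ∈ s := by
    intro i j j' hj h
    obtain ⟨⟨i', l⟩, hy, hadj⟩ := h2 _ h
    simp only [boxProd_adj, completeGraph_eq_top, top_adj, hG] at hadj
    rcases hadj with ⟨rfl | rfl, rfl⟩ | ⟨hne, rfl⟩
    · exact .inr (.inl hy)
    · exact .inr (.inr (by simpa using hy))
    · exact .inl (hj l hne.symm ▸ hy)
  rw [hc]
  apply key
  · intro i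
    have := fun h => h1 (i, 0) h (i, 1)
    simp [boxProd_adj] at this ⊢
    tauto
  · intro i
    have := fun h => h1 (i, 0) h (i + 1, 0)
    simp [boxProd_adj, hG] at this ⊢
    tauto
  · intro i
    have := fun h => h1 (i, 1) h (i + 1, 1)
    simp [boxProd_adj, hG] at this ⊢
    tauto
  · intro i
    have := hdom i 0 1 (by decide)
    simp only [Bool.or_eq_true, decide_eq_true_eq]
    tauto
  · intro i
    have := hdom i 1 0 (by decide)
    simp only [Bool.or_eq_true, decide_eq_true_eq]
    tauto

set_option synthInstance.maxSize 1000 in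
theorem isWellCovered_completeGraph_two_boxProd :
    (completeGraph (Fin 2) □ completeGraph (Fin 2)).IsWellCovered := by
  refine isWellCovered_prism_of_indicator 2 (by decide) fun a b h1 h2 h3 h4 h5 => ?_
  have key : ∀ a₀ b₀ : Bool, (a₀ && b₀) = false → ∀ a₁, (a₀ && a₁) = false →
      ∀ b₁, (b₀ && b₁) = false → (a₁ && b₁) = false →
      (a₀ || b₀ || a₁ || a₁) = true → (b₀ || a₀ || b₁ || b₁) = true →
      (a₁ || b₁ || a₀ || a₀) = true → (b₁ || a₁ || b₀ || b₀) = true →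
      a₀.toNat + b₀.toNat + (a₁.toNat + b₁.toNat) = 2 := by decide
  rw [Fin.sum_univ_two]
  exact key _ _ (h1 0) _ (h2 0) _ (h3 0) (h1 1) (h4 0) (h5 0) (h4 1) (h5 1)

set_option synthInstance.maxSize 100000 in
set_option synthInstance.maxHeartbeats 400000 in
set_option maxRecDepth 10000 in
theorem isWellCovered_cycleGraph_five_boxProd :
    (cycleGraph 5 □ completeGraph (Fin 2)).IsWellCovered := by
  refine isWellCovered_prism_of_indicator 4 (by decide) fun a b h1 h2 h3 h4 h5 => ?_
  have key : ∀ a₀ b₀ : Bool, (a₀ && b₀) = false → ∀ a₁, (a₀ && a₁) = false →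
      ∀ b₁, (b₀ && b₁) = false → (a₁ && b₁) = false →
      ∀ a₂, (a₁ && a₂) = false → ∀ b₂, (b₁ && b₂) = false → (a₂ && b₂) = false →
      ∀ a₃, (a₂ && a₃) = false → ∀ b₃, (b₂ && b₃) = false → (a₃ && b₃) = false →
      ∀ a₄, (a₃ && a₄) = false → (a₄ && a₀) = false →
      ∀ b₄, (b₃ && b₄) = false → (b₄ && b₀) = false → (a₄ && b₄) = false →
      (a₀ || b₀ || a₁ || a₄) = true → (b₀ || a₀ || b₁ || b₄) = true →
      (a₁ || b₁ || a₂ || a₀) = true → (b₁ || a₁ || b₂ || b₀) = true →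
      (a₂ || b₂ || a₃ || a₁) = true → (b₂ || a₂ || b₃ || b₁) = true →
      (a₃ || b₃ || a₄ || a₂) = true → (b₃ || a₃ || b₄ || b₂) = true →
      (a₄ || b₄ || a₀ || a₃) = true → (b₄ || a₄ || b₀ || b₃) = true →
      a₀.toNat + b₀.toNat + (a₁.toNat + b₁.toNat) + (a₂.toNat + b₂.toNat) +
        (a₃.toNat + b₃.toNat) + (a₄.toNat + b₄.toNat) = 4 := by decide
  rw [Fin.sum_univ_five]
  exact key _ _ (h1 0) _ (h2 0) _ (h3 0) (h1 1) _ (h2 1) _ (h3 1) (h1 2) _ (h2 2) _ (h3 2) (h1 3)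
    _ (h2 3) (h2 4) _ (h3 3) (h3 4) (h1 4) (h4 0) (h5 0) (h4 1) (h5 1) (h4 2) (h5 2) (h4 3) (h5 3)
    (h4 4) (h5 4)

/-! ### Leaves, and pairs of leafless factors -/

/-- In a well-covered product, a leaf `v` of a factor forces its neighbour `u` to be a leaf too:
otherwise `(v, h)` can be swapped for `(v, k)` and `(u, h)`. -/
theorem not_isWellCovered_boxProd_of_leaf [Finite V] [Finite W]
    (tG : ∀ a b c, G.Adj a b → G.Adj b c → ¬ G.Adj c a)
    (tH : ∀ a b c, H.Adj a b → H.Adj b c → ¬ H.Adj c a)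
    {u v w : V} {h k : W} (hvu : G.Adj v u) (hv : ∀ z, G.Adj v z → z = u)
    (huw : G.Adj u w) (hwv : w ≠ v) (hhk : H.Adj h k) :
    ¬ (G □ H).IsWellCovered := by
  apply not_isWellCovered_of_swap
    {z : V × W | (G.Adj u z.1 ∧ z.1 ≠ v ∧ H.Adj h z.2) ∨ (z.1 = u ∧ H.Adj k z.2 ∧ z.2 ≠ h)}
    (v, h) (v, k) (u, h)
  all_goals simp only [Prod.forall, boxProd_adj, Set.mem_ofPred_eq, Prod.exists, ne_eq,
    Prod.mk.injEq]
  all_goals have sG : ∀ a b, G.Adj a b → G.Adj b a := fun _ _ => Adj.symm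
  all_goals have sH : ∀ a b, H.Adj a b → H.Adj b a := fun _ _ => Adj.symm
  all_goals have iG : ∀ a, ¬ G.Adj a a := fun _ => G.irrefl
  all_goals have iH : ∀ a, ¬ H.Adj a a := fun _ => H.irrefl
  all_goals grind

/-- Two factors without leaves: the path `v, u, w` in the layer of `h` is isolated by using two
neighbouring layers `h₁`, `h₂` of `h` to dominate the second neighbours, and vertices `(v, k₁)`,
`(w, k₂)` further out to dominate `(v, h₁)` and `(w, h₂)`. In every other neighbouring layer of `h`, if
there is one, the nonadjacent vertices `a` and `b` dominate the copies of `v` and `w`. -/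
theorem not_isWellCovered_boxProd_of_path [Finite V] [Finite W]
    (tG : ∀ a b c, G.Adj a b → G.Adj b c → ¬ G.Adj c a)
    (tH : ∀ a b c, H.Adj a b → H.Adj b c → ¬ H.Adj c a)
    {u v w a b : V} {h h₁ h₂ k₁ k₂ : W}
    (huv : G.Adj u v) (huw : G.Adj u w) (hvw : v ≠ w)
    (hva : G.Adj v a) (hau : a ≠ u) (hwb : G.Adj w b) (hbu : b ≠ u)
    (hh₁ : H.Adj h h₁) (hh₂ : H.Adj h h₂) (hne : h₁ ≠ h₂)
    (hk₁ : H.Adj h₁ k₁) (hkh₁ : k₁ ≠ h) (hk₂ : H.Adj h₂ k₂) (hkh₂ : k₂ ≠ h)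
    (hab : G.Adj a b → ∀ j, H.Adj h j → j = h₁ ∨ j = h₂) :
    ¬ (G □ H).IsWellCovered := by
  apply not_isWellCovered_of_swap
    {z : V × W | (G.Adj w z.1 ∧ z.1 ≠ u ∧ z.2 = h₁) ∨ (G.Adj v z.1 ∧ z.1 ≠ u ∧ z.2 = h₂) ∨
      ((z.1 = a ∨ z.1 = b) ∧ H.Adj h z.2 ∧ z.2 ≠ h₁ ∧ z.2 ≠ h₂) ∨
      (z.1 = v ∧ z.2 = k₁) ∨ (z.1 = w ∧ z.2 = k₂)}
    (u, h) (v, h) (w, h)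
  all_goals simp only [Prod.forall, boxProd_adj, Set.mem_ofPred_eq, Prod.exists, ne_eq,
    Prod.mk.injEq]
  all_goals have sG : ∀ a b, G.Adj a b → G.Adj b a := fun _ _ => Adj.symm
  all_goals have sH : ∀ a b, H.Adj a b → H.Adj b a := fun _ _ => Adj.symm
  all_goals have iG : ∀ a, ¬ G.Adj a a := fun _ => G.irrefl
  all_goals have iH : ∀ a, ¬ H.Adj a a := fun _ => H.irrefl
  all_goals grind

/-- In a well-covered product, each factor is an edge or has no leaves. -/
theorem IsWellCovered.edge_or_leafless [Finite V] [Finite W]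
    (tG : ∀ a b c, G.Adj a b → G.Adj b c → ¬ G.Adj c a)
    (tH : ∀ a b c, H.Adj a b → H.Adj b c → ¬ H.Adj c a)
    (hH : ∃ h k, H.Adj h k) (hwc : (G □ H).IsWellCovered) :
    (∃ u v, G.Adj u v ∧ (∀ x, G.Adj u x → x = v) ∧ ∀ x, G.Adj v x → x = u) ∨
      ∀ x y, G.Adj x y → ∃ z, z ≠ y ∧ G.Adj x z := by
  obtain ⟨h, k, hhk⟩ := hH
  by_contra! hcon
  obtain ⟨h1, v, u, hvu, hv⟩ := hcon
  have hv' : ∀ z, G.Adj v z → z = u := fun z hz => by_contra fun hne => hv z hne hz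
  obtain ⟨w, huw, hwv⟩ := h1 v u hvu hv'
  exact not_isWellCovered_boxProd_of_leaf tG tH hvu hv' huw hwv hhk hwc

/-- The case in which `H` has a vertex of degree two: the layers over its two neighbours suffice, so
no condition on the second neighbours in `G` is needed. -/
theorem not_isWellCovered_boxProd_of_leafless_of_degree_two [Finite V] [Finite W]
    (tG : ∀ a b c, G.Adj a b → G.Adj b c → ¬ G.Adj c a)
    (tH : ∀ a b c, H.Adj a b → H.Adj b c → ¬ H.Adj c a)
    (lG : ∀ x y, G.Adj x y → ∃ z, z ≠ y ∧ G.Adj x z)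
    (lH : ∀ x y, H.Adj x y → ∃ z, z ≠ y ∧ H.Adj x z)
    (eG : ∃ u v, G.Adj u v) {h h₁ h₂ : W}
    (hh₁ : H.Adj h h₁) (hh₂ : H.Adj h h₂) (hne : h₁ ≠ h₂) (hh : ∀ j, H.Adj h j → j = h₁ ∨ j = h₂) :
    ¬ (G □ H).IsWellCovered := by
  obtain ⟨u, v, huv⟩ := eG
  obtain ⟨w, hwv, huw⟩ := lG u v huv
  obtain ⟨a, hau, hva⟩ := lG v u huv.symm
  obtain ⟨b, hbu, hwb⟩ := lG w u huw.symm
  obtain ⟨k₁, hk₁, hhk₁⟩ := lH h₁ h hh₁.symm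
  obtain ⟨k₂, hk₂, hhk₂⟩ := lH h₂ h hh₂.symm
  exact not_isWellCovered_boxProd_of_path tG tH huv huw hwv.symm hva hau hwb hbu hh₁ hh₂ hne hhk₁
    hk₁ hhk₂ hk₂ fun _ => hh

/-- A neighbour `v` of the centre of a path in `G` either has degree two, and then serves as the
middle layer after exchanging the factors, or has enough neighbours for the path swap in `G`. -/
theorem not_isWellCovered_boxProd_of_leafless [Finite V] [Finite W]
    (tG : ∀ a b c, G.Adj a b → G.Adj b c → ¬ G.Adj c a)
    (cG : ∀ a b c d, a ≠ c → b ≠ d → G.Adj a b → G.Adj b c → G.Adj c d → ¬ G.Adj d a)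
    (tH : ∀ a b c, H.Adj a b → H.Adj b c → ¬ H.Adj c a)
    (lG : ∀ x y, G.Adj x y → ∃ z, z ≠ y ∧ G.Adj x z)
    (lH : ∀ x y, H.Adj x y → ∃ z, z ≠ y ∧ H.Adj x z)
    (eG : ∃ u v, G.Adj u v) (eH : ∃ h k, H.Adj h k) :
    ¬ (G □ H).IsWellCovered := by
  obtain ⟨u, v, huv⟩ := eG
  obtain ⟨w, hwv, huw⟩ := lG u v huv
  obtain ⟨a, hau, hva⟩ := lG v u huv.symm
  obtain ⟨b, hbu, hwb⟩ := lG w u huw.symm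
  by_cases hv : ∀ j, G.Adj v j → j = u ∨ j = a
  · -- A degree-two vertex of `G` serves as the middle layer with the factors exchanged.
    intro hwc
    exact not_isWellCovered_boxProd_of_leafless_of_degree_two tH tG lH lG eH huv.symm hva
      hau.symm hv (hwc.of_iso (boxProdComm H G))
  · push Not at hv
    obtain ⟨a', hva', ha'u, ha'a⟩ := hv
    obtain ⟨h, h₁, hh₁⟩ := eH
    obtain ⟨h₂, hh₂₁, hh₂⟩ := lH h h₁ hh₁
    obtain ⟨k₁, hk₁, hhk₁⟩ := lH h₁ h hh₁.symm
    obtain ⟨k₂, hk₂, hhk₂⟩ := lH h₂ h hh₂.symm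
    -- With two second neighbours behind `v`, one of them is not adjacent to `b`.
    obtain ⟨c, hvc, hcu, hcb⟩ : ∃ c, G.Adj v c ∧ c ≠ u ∧ ¬ G.Adj c b := by
      by_cases hab : G.Adj a b
      · refine ⟨a', hva', ha'u, fun ha'b => ?_⟩
        have hvb : v ≠ b := by
          rintro rfl
          exact tG u w v huw hwb huv.symm
        exact cG v a b a' hvb ha'a.symm hva hab ha'b.symm hva'.symm
      · exact ⟨a, hva, hau, hab⟩
    exact not_isWellCovered_boxProd_of_path tG tH huv huw hwv.symm hvc hcu hwb hbu hh₁ hh₂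
      hh₂₁.symm hhk₁ hk₁ hhk₂ hk₂ fun h => absurd h hcb

/-! ### Prisms over leafless graphs -/

/-- The path `q, u, r` in the layer of `h` is isolated by `A` in that layer and `B` in the layer of
`k`. The members of `B` are second neighbours of `u`; they dominate the copies of `q` and `r` in the
layer of `k`, and themselves in the layer of `h`. -/
theorem not_isWellCovered_prism_of_path [Finite V] [Finite W]
    (tG : ∀ a b c, G.Adj a b → G.Adj b c → ¬ G.Adj c a)
    {h k : W} (hhk : H.Adj h k) (hh : ∀ x, H.Adj h x → x = k)
    {u q r : V} (huq : G.Adj u q) (hur : G.Adj u r) (hqr : q ≠ r) (A B : Set V)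
    (hA : ∀ x ∈ A, ∀ y ∈ A, ¬ G.Adj x y) (hB : ∀ x ∈ B, ∀ y ∈ B, ¬ G.Adj x y)
    (hAB : ∀ x ∈ A, x ∉ B)
    (hA' : ∀ x ∈ A, ¬ G.Adj u x ∧ ¬ G.Adj q x ∧ ¬ G.Adj r x)
    (hB' : ∀ x ∈ B, x ≠ u ∧ (G.Adj q x ∨ G.Adj r x))
    (hBq : ∃ x ∈ B, G.Adj q x) (hBr : ∃ x ∈ B, G.Adj r x)
    (hdom : ∀ x, x ≠ u → G.Adj q x ∨ G.Adj r x → x ∈ B ∨ ∃ a ∈ A, G.Adj a x) :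
    ¬ (G □ H).IsWellCovered := by
  apply not_isWellCovered_of_swap
    {z : V × W | (z.1 ∈ A ∧ z.2 = h) ∨ (z.1 ∈ B ∧ z.2 = k)} (u, h) (q, h) (r, h)
  all_goals simp only [Prod.forall, boxProd_adj, Set.mem_ofPred_eq, Prod.exists, ne_eq,
    Prod.mk.injEq]
  all_goals have sG : ∀ a b, G.Adj a b → G.Adj b a := fun _ _ => Adj.symm
  all_goals have sH : ∀ a b, H.Adj a b → H.Adj b a := fun _ _ => Adj.symm
  all_goals have iG : ∀ a, ¬ G.Adj a a := fun _ => G.irrefl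
  all_goals have iH : ∀ a, ¬ H.Adj a a := fun _ => H.irrefl
  all_goals obtain ⟨b, hb, hqb⟩ := hBq
  all_goals obtain ⟨b', hb', hrb'⟩ := hBr
  -- Only `(b, k)` and `(b', k)` dominate `(q, k)` and `(r, k)`.
  case hNq =>
    rintro x l (⟨hx, rfl⟩ | ⟨hl, rfl⟩) hne
    · rcases hdom x (by tauto) (.inl hx) with h | ⟨a, ha, hax⟩
      · exact ⟨x, k, by tauto, .inr ⟨hhk.symm, rfl⟩⟩
      · exact ⟨a, h, by tauto, .inl ⟨hax, rfl⟩⟩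
    · exact ⟨b, k, by tauto, .inl ⟨hqb.symm, (hh l hl).symm⟩⟩
  case hNr =>
    rintro x l (⟨hx, rfl⟩ | ⟨hl, rfl⟩) hne
    · rcases hdom x (by tauto) (.inr hx) with h | ⟨a, ha, hax⟩
      · exact ⟨x, k, by tauto, .inr ⟨hhk.symm, rfl⟩⟩
      · exact ⟨a, h, by tauto, .inl ⟨hax, rfl⟩⟩
    · exact ⟨b', k, by tauto, .inl ⟨hrb'.symm, (hh l hl).symm⟩⟩
  all_goals grind

/-- In a graph without four-cycles, an independent set `A₀` extends greedily to one that dominates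
all targets `s ∈ T` through prescribed candidate sets `P s`: each vertex already chosen is
adjacent to at most one candidate of `s`. -/
theorem exists_indep_dominating_targets
    (cG : ∀ a b c d, a ≠ c → b ≠ d → G.Adj a b → G.Adj b c → G.Adj c d → ¬ G.Adj d a)
    (P : V → Finset V) (T A₀ : Finset V)
    (hA₀ : ∀ x ∈ A₀, ∀ y ∈ A₀, ¬ G.Adj x y) (hA₀T : ∀ x ∈ A₀, x ∉ T)
    (hP : ∀ s ∈ T, ∀ p ∈ P s, G.Adj s p ∧ p ∉ T)
    (hcard : ∀ s ∈ T, A₀.card + T.card ≤ (P s).card) :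
    ∃ A : Finset V, A₀ ⊆ A ∧ (∀ x ∈ A, ∀ y ∈ A, ¬ G.Adj x y) ∧
      (∀ x ∈ A, x ∈ A₀ ∨ ∃ s ∈ T, x ∈ P s) ∧ ∀ s ∈ T, ∃ x ∈ A, G.Adj x s := by
  classical
  induction T using Finset.induction_on generalizing A₀ with
  | empty => exact ⟨A₀, subset_rfl, hA₀, fun x hx => .inl hx, by simp⟩
  | insert s T hs ih =>
    obtain ⟨p, hp, hpA⟩ : ∃ p ∈ P s, ∀ x ∈ A₀, ¬ G.Adj p x := by
      by_contra! hcon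
      choose! f hf hf' using hcon
      have hc := hcard s (Finset.mem_insert_self _ _)
      rw [Finset.card_insert_of_notMem hs] at hc
      obtain ⟨p, hp, p', hp', hne, heq⟩ :=
        Finset.exists_ne_map_eq_of_card_lt_of_maps_to (s := P s) (t := A₀) (f := f) (by omega) hf
      have h1 := (hP s (Finset.mem_insert_self _ _) p hp).1
      have h2 := (hP s (Finset.mem_insert_self _ _) p' hp').1
      have hsf : s ≠ f p := fun h => hA₀T _ (hf p hp) (h ▸ Finset.mem_insert_self _ _)
      exact cG s p (f p) p' hsf hne h1 (hf' p hp) (heq ▸ (hf' p' hp').symm) h2.symm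
    have hps := hP s (Finset.mem_insert_self _ _) p hp
    obtain ⟨A, hA, hAi, hAP, hAd⟩ := ih (insert p A₀)
      (by
        simp only [Finset.mem_insert]
        rintro x (rfl | hx) y (rfl | hy)
        · exact G.irrefl
        · exact hpA y hy
        · exact fun h => hpA x hx h.symm
        · exact hA₀ x hx y hy)
      (by grind) (by grind)
      (fun t ht => by
        have := hcard t (Finset.mem_insert_of_mem ht)
        rw [Finset.card_insert_of_notMem hs] at this
        have := Finset.card_insert_le p A₀
        omega)
    refine ⟨A, fun x hx => hA (Finset.mem_insert_of_mem hx), hAi, by grind, fun t ht => ?_⟩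
    rcases Finset.mem_insert.1 ht with rfl | ht
    · exact ⟨p, hA (Finset.mem_insert_self _ _), hps.1.symm⟩
    · exact hAd t ht

/-- Without four-cycles, at most two neighbours of `a` are lost by excluding `q` and the neighbours
of `r`. -/
theorem degree_le_card_erase_sdiff_add_two [Fintype V] [DecidableEq V] [DecidableRel G.Adj]
    (cG : ∀ a b c d, a ≠ c → b ≠ d → G.Adj a b → G.Adj b c → G.Adj c d → ¬ G.Adj d a)
    {a r : V} (q : V) (har : a ≠ r) :
    G.degree a ≤ ((G.neighborFinset a).erase q \ G.neighborFinset r).card + 2 := by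
  have h1 : (G.neighborFinset a ∩ G.neighborFinset r).card ≤ 1 := by
    rw [Finset.card_le_one]
    intro x hx y hy
    simp only [Finset.mem_inter, mem_neighborFinset] at hx hy
    by_contra hxy
    exact cG a x r y har hxy hx.1 hx.2.symm hy.2 hy.1.symm
  have h2 : G.neighborFinset a ⊆ ((G.neighborFinset a).erase q \ G.neighborFinset r) ∪
      (G.neighborFinset a ∩ G.neighborFinset r) ∪ {q} := by
    intro x hx
    simp only [Finset.mem_union, Finset.mem_sdiff, Finset.mem_erase, Finset.mem_inter,
      Finset.mem_singleton]
    tauto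
  have h3 := Finset.card_le_card h2
  have h4 := Finset.card_union_le (((G.neighborFinset a).erase q \ G.neighborFinset r) ∪
      (G.neighborFinset a ∩ G.neighborFinset r)) {q}
  have h5 := Finset.card_union_le ((G.neighborFinset a).erase q \ G.neighborFinset r)
      (G.neighborFinset a ∩ G.neighborFinset r)
  rw [Finset.card_singleton] at h4
  rw [← card_neighborFinset_eq_degree]
  omega

/-- Around a vertex `q` of minimum degree: every neighbour `a` of `q` has a common neighbour with
every second neighbour `r` of `q`. Otherwise few enough neighbours of `q` need to be dominated for
the greedy choice to isolate the path `q, u, r`. -/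
theorem IsWellCovered.exists_common_neighbor [Fintype V] [DecidableRel G.Adj] [Finite W]
    (tG : ∀ a b c, G.Adj a b → G.Adj b c → ¬ G.Adj c a)
    (cG : ∀ a b c d, a ≠ c → b ≠ d → G.Adj a b → G.Adj b c → G.Adj c d → ¬ G.Adj d a)
    (leafless : ∀ x y, G.Adj x y → ∃ z, z ≠ y ∧ G.Adj x z)
    {h k : W} (hhk : H.Adj h k) (hh : ∀ x, H.Adj h x → x = k) (hwc : (G □ H).IsWellCovered)
    {q : V} (hmin : ∀ a, G.degree q ≤ G.degree a)
    {u r a : V} (huq : G.Adj u q) (hur : G.Adj u r) (hrq : r ≠ q) (hqa : G.Adj q a) (hau : a ≠ u) :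
    ∃ b, G.Adj a b ∧ G.Adj b r := by
  classical
  by_contra! hcon
  -- `T` holds the neighbours of `q` that cannot be put into the other layer together with those
  -- of `r`; they are dominated within the layer of the path.
  let T := ((G.neighborFinset q).erase u).filter fun x => ∃ b, G.Adj x b ∧ G.Adj b r
  have hT : ∀ x, x ∈ T ↔ (x ≠ u ∧ G.Adj q x) ∧ ∃ b, G.Adj x b ∧ G.Adj b r := by
    intro x; simp [T]
  have hTcard : T.card + 2 ≤ G.degree q := by
    have h1 : T ⊆ ((G.neighborFinset q).erase u).erase a := by
      intro x hx
      have := (hT x).1 hx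
      simp only [Finset.mem_erase, mem_neighborFinset]
      refine ⟨?_, this.1⟩
      rintro rfl
      obtain ⟨b, hb, hb'⟩ := this.2
      exact hcon b hb hb'
    have h2 := Finset.card_le_card h1
    have ha : a ∈ (G.neighborFinset q).erase u := by simp [hqa, hau]
    have hu : u ∈ G.neighborFinset q := by simp [huq.symm]
    have h3 := Finset.card_erase_add_one ha
    have h4 := Finset.card_erase_add_one hu
    rw [card_neighborFinset_eq_degree] at h4
    omega
  obtain ⟨A, -, hAi, hAP, hAd⟩ := exists_indep_dominating_targets cG
    (fun x => (G.neighborFinset x).erase q \ G.neighborFinset r) T ∅ (by simp) (by simp)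
    (by
      intro s hs p hp
      have := ((hT s).1 hs).1.2
      simp only [Finset.mem_sdiff, Finset.mem_erase, mem_neighborFinset] at hp
      exact ⟨hp.1.2, fun hpT => tG q s p this hp.1.2 ((hT p).1 hpT).1.2.symm⟩)
    (by
      intro s hs
      have hsr : s ≠ r := by
        rintro rfl
        exact tG u q s huq ((hT s).1 hs).1.2 hur.symm
      have := degree_le_card_erase_sdiff_add_two cG q hsr
      have := hmin s
      simp only [Finset.card_empty]
      omega)
  have hAP' : ∀ x ∈ A, x ≠ q ∧ ¬ G.Adj r x ∧ ∃ s, s ≠ u ∧ G.Adj q s ∧ G.Adj s x := by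
    intro x hx
    rcases hAP x hx with h | ⟨s, hs, h⟩
    · simp at h
    · simp only [Finset.mem_sdiff, Finset.mem_erase, mem_neighborFinset] at h
      have := (hT s).1 hs
      exact ⟨h.1.1, h.2, s, this.1.1, this.1.2, h.1.2⟩
  clear_value T
  have sG : ∀ a b, G.Adj a b → G.Adj b a := fun _ _ => Adj.symm
  obtain ⟨r', hr'u, hrr'⟩ := leafless r u hur.symm
  have hA' : ∀ x ∈ A, ¬ G.Adj u x ∧ ¬ G.Adj q x ∧ ¬ G.Adj r x := by
    intro x hx
    obtain ⟨hxq, hrx, s, hsu, hqs, hsx⟩ := hAP' x hx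
    exact ⟨fun hux => cG q s x u hxq.symm hsu hqs hsx hux.symm huq,
      fun hqx => tG q s x hqs hsx hqx.symm, hrx⟩
  refine not_isWellCovered_prism_of_path tG hhk hh huq hur hrq.symm (A : Set V)
    {b | b ≠ u ∧ ((G.Adj q b ∧ b ∉ T) ∨ G.Adj r b)} ?_ ?_ ?_ ?_ ?_ ?_ ?_ ?_ hwc
  · exact hAi
  · have key : ∀ x y, x ≠ u → G.Adj q x → x ∉ T → G.Adj r y → ¬ G.Adj x y :=
      fun x y hxu hqx hxT hry hxy => hxT ((hT x).2 ⟨⟨hxu, hqx⟩, y, hxy, hry.symm⟩)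
    rintro x ⟨hxu, ⟨hx, hxT⟩ | hx⟩ y ⟨hyu, ⟨hy, hyT⟩ | hy⟩ hxy
    · exact tG q x y hx hxy hy.symm
    · exact key x y hxu hx hxT hy hxy
    · exact key y x hyu hy hyT hx hxy.symm
    · exact tG r x y hx hxy hy.symm
  · rintro x hx ⟨-, h⟩
    have := hA' x hx
    tauto
  · exact hA'
  · rintro x ⟨h1, h2⟩
    tauto
  · refine ⟨a, ⟨hau, .inl ⟨hqa, fun ha => ?_⟩⟩, hqa⟩
    obtain ⟨b, hb, hb'⟩ := ((hT a).1 ha).2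
    exact hcon b hb hb'
  · exact ⟨r', ⟨hr'u, .inr hrr'⟩, hrr'⟩
  · intro x hxu hx
    by_cases hxT : x ∈ T
    · exact .inr (hAd x hxT)
    · exact .inl ⟨hxu, by tauto⟩

/-- With a minimum degree vertex `q` of degree at least three, pick neighbours `u, u₁, u₂` of `q`
and a second neighbour `r` via `u`. A common neighbour `d` of `u₁` and of a common neighbour `b₂` of
`u₂` and `r` dominates two targets at once, which leaves enough room for the greedy choice. -/
theorem not_isWellCovered_prism_of_three_le_degree [Fintype V] [DecidableRel G.Adj] [Finite W]
    (tG : ∀ a b c, G.Adj a b → G.Adj b c → ¬ G.Adj c a)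
    (cG : ∀ a b c d, a ≠ c → b ≠ d → G.Adj a b → G.Adj b c → G.Adj c d → ¬ G.Adj d a)
    (leafless : ∀ x y, G.Adj x y → ∃ z, z ≠ y ∧ G.Adj x z)
    {h k : W} (hhk : H.Adj h k) (hh : ∀ x, H.Adj h x → x = k)
    {q : V} (hmin : ∀ a, G.degree q ≤ G.degree a) (hq : 3 ≤ G.degree q) :
    ¬ (G □ H).IsWellCovered := by
  classical
  intro hwc
  have full : ∀ u r a, G.Adj u q → G.Adj u r → r ≠ q → G.Adj q a → a ≠ u →
      ∃ b, G.Adj a b ∧ G.Adj b r := fun u r a h1 h2 h3 h4 h5 =>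
    hwc.exists_common_neighbor tG cG leafless hhk hh hmin h1 h2 h3 h4 h5
  rw [← card_neighborFinset_eq_degree] at hq
  obtain ⟨u, u₁, u₂, hu, hu₁, hu₂, huu₁, huu₂, huu₁₂⟩ := Finset.two_lt_card_iff.1 hq
  rw [mem_neighborFinset] at hu hu₁ hu₂
  have sG : ∀ a b, G.Adj a b → G.Adj b a := fun _ _ => Adj.symm
  have iG : ∀ a, ¬ G.Adj a a := fun _ => G.irrefl
  obtain ⟨r, hrq, hur⟩ := leafless u q hu.symm
  obtain ⟨b₁, hb₁, hb₁r⟩ := full u r u₁ hu.symm hur hrq hu₁ huu₁.symm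
  obtain ⟨b₂, hb₂, hb₂r⟩ := full u r u₂ hu.symm hur hrq hu₂ huu₂.symm
  have hb₂q : b₂ ≠ q := by grind
  obtain ⟨d, hd₁, hd₂⟩ := full u₂ b₂ u₁ hu₂.symm hb₂ hb₂q hu₁ huu₁₂
  have hdq : d ≠ q := by grind
  -- The remaining neighbours of `q` are the targets. Those of `r` other than `b₂`, and `u₂`, go into
  -- the other layer; `u₁` and `b₂` are dominated by `d`.
  let T := (((G.neighborFinset q).erase u).erase u₁).erase u₂
  have hT : ∀ x, x ∈ T ↔ x ≠ u₂ ∧ x ≠ u₁ ∧ x ≠ u ∧ G.Adj q x := by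
    intro x; simp [T]
  have hTcard : T.card + 3 = G.degree q := by
    have h1 : u ∈ G.neighborFinset q := by simpa
    have h2 : u₁ ∈ (G.neighborFinset q).erase u := by simp [*, huu₁.symm]
    have h3 : u₂ ∈ ((G.neighborFinset q).erase u).erase u₁ := by
      simp [*, huu₂.symm, huu₁₂.symm]
    have h4 := Finset.card_erase_add_one h1
    have h5 := Finset.card_erase_add_one h2
    have h6 := Finset.card_erase_add_one h3
    rw [card_neighborFinset_eq_degree] at h4
    simp only [T]
    omega
  obtain ⟨A, hdA, hAi, hAP, hAd⟩ := exists_indep_dominating_targets cG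
    (fun x => (G.neighborFinset x).erase q \ G.neighborFinset r) T {d} (by simp)
    (by
      intro x hx hxT
      rw [Finset.mem_singleton] at hx
      subst hx
      exact tG q u₁ x hu₁ hd₁ ((hT x).1 hxT).2.2.2.symm)
    (by
      intro s hs p hp
      have := ((hT s).1 hs).2.2.2
      simp only [Finset.mem_sdiff, Finset.mem_erase, mem_neighborFinset] at hp
      exact ⟨hp.1.2, fun hpT => tG q s p this hp.1.2 ((hT p).1 hpT).2.2.2.symm⟩)
    (by
      intro s hs
      have hsr : s ≠ r := by
        rintro rfl
        exact tG u q s hu.symm ((hT s).1 hs).2.2.2 hur.symm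
      have := degree_le_card_erase_sdiff_add_two cG q hsr
      have := hmin s
      simp only [Finset.card_singleton]
      omega)
  have hdA' : d ∈ A := hdA (Finset.mem_singleton_self d)
  have hdr : ¬ G.Adj r d := fun h => tG r d b₂ h hd₂ hb₂r
  have hA' : ∀ x ∈ A, ¬ G.Adj u x ∧ ¬ G.Adj q x ∧ ¬ G.Adj r x := by
    have aux : ∀ x s, x ≠ q → ¬ G.Adj r x → s ≠ u → G.Adj q s → G.Adj s x →
        ¬ G.Adj u x ∧ ¬ G.Adj q x ∧ ¬ G.Adj r x := fun x s hxq hrx hsu hqs hsx =>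
      ⟨fun hux => cG q s x u hxq.symm hsu hqs hsx hux.symm hu.symm,
        fun hqx => tG q s x hqs hsx hqx.symm, hrx⟩
    intro x hx
    rcases hAP x hx with h | ⟨s, hs, h⟩
    · rw [Finset.mem_singleton] at h
      subst h
      exact aux x u₁ hdq hdr huu₁.symm hu₁ hd₁
    · simp only [Finset.mem_sdiff, Finset.mem_erase, mem_neighborFinset] at h
      have := (hT s).1 hs
      exact aux x s h.1.1 h.2 this.2.2.1 this.2.2.2 h.1.2
  clear_value T
  refine not_isWellCovered_prism_of_path tG hhk hh hu.symm hur hrq.symm (A : Set V)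
    {b | b = u₂ ∨ (G.Adj r b ∧ b ≠ u ∧ b ≠ b₂)} ?_ ?_ ?_ ?_ ?_ ?_ ?_ ?_ hwc
  · exact hAi
  · rintro x hx y hy hxy
    simp only [Set.mem_ofPred_eq] at hx hy
    have key : ∀ z, G.Adj r z → z ≠ b₂ → ¬ G.Adj u₂ z := fun z hrz hz huz =>
      cG r z u₂ b₂ (by grind) hz hrz huz.symm hb₂ hb₂r
    rcases hx with rfl | ⟨hx, -, hx'⟩ <;> rcases hy with rfl | ⟨hy, -, hy'⟩
    · exact iG _ hxy
    · exact key y hy hy' hxy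
    · exact key x hx hx' hxy.symm
    · exact tG r x y hx hxy hy.symm
  · rintro x hx (rfl | h)
    · exact (hA' x hx).2.1 hu₂
    · exact (hA' x hx).2.2 h.1
  · exact hA'
  · rintro x (rfl | h)
    · exact ⟨huu₂.symm, .inl hu₂⟩
    · exact ⟨h.2.1, .inr h.1⟩
  · exact ⟨u₂, .inl rfl, hu₂⟩
  · refine ⟨b₁, .inr ⟨hb₁r.symm, ?_, ?_⟩, hb₁r.symm⟩
    · rintro rfl
      exact tG q u₁ b₁ hu₁ hb₁ hu.symm
    · rintro rfl
      exact cG q u₁ b₁ u₂ hb₂q.symm huu₁₂ hu₁ hb₁ hb₂.symm hu₂.symm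
  · rintro x hxu hx
    by_cases hx₂ : x = b₂
    · exact .inr ⟨d, hdA', hx₂ ▸ hd₂⟩
    by_cases hx₁ : x = u₁
    · exact .inr ⟨d, hdA', hx₁ ▸ hd₁.symm⟩
    rcases hx with hx | hx
    · by_cases h2 : x = u₂
      · exact .inl (.inl h2)
      · exact .inr (hAd x ((hT x).2 ⟨h2, hx₁, hxu, hx⟩))
    · exact .inl (.inr ⟨hx, hxu, hx₂⟩)

/-- Around a vertex `q` of degree two with neighbours `u` and `y`: the swap of `(q, h)` for `(q, k)` and
`(u, h)`. The vertex `(x', h)` dominates `(x, h)`, whose copy in the other layer is excluded by the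
edge `x z`. -/
theorem not_isWellCovered_prism_of_degree_two [Finite V] [Finite W]
    (tG : ∀ a b c, G.Adj a b → G.Adj b c → ¬ G.Adj c a)
    (cG : ∀ a b c d, a ≠ c → b ≠ d → G.Adj a b → G.Adj b c → G.Adj c d → ¬ G.Adj d a)
    {h k : W} (hhk : H.Adj h k) (hh : ∀ x, H.Adj h x → x = k) (hk : ∀ x, H.Adj k x → x = h)
    {q u y x x₁ x' z : V} (hq : ∀ a, G.Adj q a ↔ a = u ∨ a = y)
    (hux : G.Adj u x) (hux₁ : G.Adj u x₁) (hx₁q : x₁ ≠ q) (hx₁x : x₁ ≠ x)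
    (hyz : G.Adj y z) (hxz : G.Adj x z) (hxx' : G.Adj x x') (hx'u : x' ≠ u) (hx'z : x' ≠ z) :
    ¬ (G □ H).IsWellCovered := by
  have hqu : G.Adj q u := (hq u).2 (.inl rfl)
  have hqy : G.Adj q y := (hq y).2 (.inr rfl)
  have hq' : ∀ a, G.Adj q a → a = u ∨ a = y := fun a => (hq a).1
  clear hq
  have sG : ∀ a b, G.Adj a b → G.Adj b a := fun _ _ => Adj.symm
  have huz : u ≠ z := by grind
  have hbz : ∀ b, G.Adj u b → b ≠ x → ¬ G.Adj b z := fun b hb hbx hbz =>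
    cG u x z b huz hbx.symm hux hxz hbz.symm hb.symm
  clear cG
  apply not_isWellCovered_of_swap
    {w : V × W | (G.Adj u w.1 ∧ w.1 ≠ q ∧ w.1 ≠ x ∧ w.2 = k) ∨ (w.1 = z ∧ w.2 = k) ∨
      (w.1 = x' ∧ w.2 = h)} (q, h) (q, k) (u, h)
  all_goals simp only [Prod.forall, boxProd_adj, Set.mem_ofPred_eq, Prod.exists, ne_eq,
    Prod.mk.injEq]
  all_goals have sH : ∀ a b, H.Adj a b → H.Adj b a := fun _ _ => Adj.symm
  all_goals have iG : ∀ a, ¬ G.Adj a a := fun _ => G.irrefl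
  all_goals have iH : ∀ a, ¬ H.Adj a a := fun _ => H.irrefl
  case hNr =>
    rintro a l (⟨ha, rfl⟩ | ⟨hl, rfl⟩) hne
    · by_cases hax : a = x
      · exact ⟨x', h, by tauto, .inl ⟨hax ▸ hxx'.symm, rfl⟩⟩
      · exact ⟨a, k, .inl ⟨ha, by tauto, hax, rfl⟩, .inr ⟨hhk.symm, rfl⟩⟩
    · exact ⟨x₁, k, .inl ⟨hux₁, hx₁q, hx₁x, rfl⟩, .inl ⟨hux₁.symm, (hh l hl).symm⟩⟩
  all_goals grind

/-- The neighbours of a degree-two vertex again have degree two. -/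
theorem IsWellCovered.neighbor_of_degree_two [Fintype V] [DecidableRel G.Adj] [Finite W]
    (tG : ∀ a b c, G.Adj a b → G.Adj b c → ¬ G.Adj c a)
    (cG : ∀ a b c d, a ≠ c → b ≠ d → G.Adj a b → G.Adj b c → G.Adj c d → ¬ G.Adj d a)
    (leafless : ∀ x y, G.Adj x y → ∃ z, z ≠ y ∧ G.Adj x z)
    {h k : W} (hhk : H.Adj h k) (hh : ∀ x, H.Adj h x → x = k) (hk : ∀ x, H.Adj k x → x = h)
    (hwc : (G □ H).IsWellCovered) (hdeg : ∀ a, 2 ≤ G.degree a)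
    {q u y : V} (hq : ∀ a, G.Adj q a ↔ a = u ∨ a = y) (huy : u ≠ y) :
    ∃ x, x ≠ q ∧ ∀ a, G.Adj u a ↔ a = q ∨ a = x := by
  classical
  have full : ∀ q u y, (∀ a, G.Adj q a → a = u ∨ a = y) → ∀ u r a, G.Adj u q → G.Adj u r → r ≠ q →
      G.Adj q a → a ≠ u → ∃ b, G.Adj a b ∧ G.Adj b r := by
    intro q u y hq u' r a h1 h2 h3 h4 h5
    refine hwc.exists_common_neighbor tG cG leafless hhk hh (fun a => ?_) h1 h2 h3 h4 h5
    refine le_trans ?_ (hdeg a)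
    rw [← card_neighborFinset_eq_degree]
    refine (Finset.card_le_card (t := {u, y}) fun a ha => ?_).trans Finset.card_le_two
    simpa using hq a (by simpa using ha)
  have hqu : G.Adj q u := (hq u).2 (.inl rfl)
  have hqy : G.Adj q y := (hq y).2 (.inr rfl)
  obtain ⟨x, hxq, hux⟩ := leafless u q hqu.symm
  refine ⟨x, hxq, fun x₁ => ⟨fun hux₁ => ?_, ?_⟩⟩
  · by_contra! hx₁
    obtain ⟨hx₁q, hx₁x⟩ := hx₁
    obtain ⟨z, hyz, hzx⟩ := full q u y (fun a => (hq a).1) u x y hqu.symm hux hxq hqy huy.symm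
    obtain ⟨z₁, hyz₁, hzx₁⟩ := full q u y (fun a => (hq a).1) u x₁ y hqu.symm hux₁ hx₁q hqy huy.symm
    -- Both `x` and `x₁` have degree two, since a third neighbour would allow the cross-layer swap.
    have hx2 : ∀ a, G.Adj x a → a = u ∨ a = z := by
      intro a ha
      by_contra! hcon
      exact not_isWellCovered_prism_of_degree_two tG cG hhk hh hk hq hux hux₁ hx₁q hx₁x hyz
        hzx.symm ha hcon.1 hcon.2 hwc
    have hx₁2 : ∀ a, G.Adj x₁ a → a = u ∨ a = z₁ := by
      intro a ha
      by_contra! hcon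
      exact not_isWellCovered_prism_of_degree_two tG cG hhk hh hk hq hux₁ hux hxq hx₁x.symm
        hyz₁ hzx₁.symm ha hcon.1 hcon.2 hwc
    have hzu : z ≠ u := by
      rintro rfl
      exact tG q y z hqy hyz hqu.symm
    obtain ⟨b, hzb, hbx₁⟩ := full x u z hx2 u x₁ z hux hux₁ hx₁x hzx.symm hzu
    rcases hx₁2 b hbx₁.symm with rfl | rfl
    · exact tG b x z hux hzx.symm hzb
    · exact tG y z b hyz hzb hyz₁.symm
  · rintro (rfl | rfl)
    exacts [hqu.symm, hux]

/-- A degree-two vertex forces the whole factor to be a five-cycle. -/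
theorem IsWellCovered.nonempty_iso_cycleGraph_five [Fintype V] [DecidableRel G.Adj] [Finite W]
    (hG : G.Connected)
    (tG : ∀ a b c, G.Adj a b → G.Adj b c → ¬ G.Adj c a)
    (cG : ∀ a b c d, a ≠ c → b ≠ d → G.Adj a b → G.Adj b c → G.Adj c d → ¬ G.Adj d a)
    (leafless : ∀ x y, G.Adj x y → ∃ z, z ≠ y ∧ G.Adj x z)
    {h k : W} (hhk : H.Adj h k) (hh : ∀ x, H.Adj h x → x = k) (hk : ∀ x, H.Adj k x → x = h)
    (hwc : (G □ H).IsWellCovered) (hdeg : ∀ a, 2 ≤ G.degree a)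
    {q : V} (hq2 : G.degree q = 2) :
    Nonempty (G ≃g cycleGraph 5) := by
  classical
  have nb : ∀ q u y : V, (∀ a, G.Adj q a ↔ a = u ∨ a = y) → u ≠ y →
      ∃ x, x ≠ q ∧ ∀ a, G.Adj u a ↔ a = q ∨ a = x := fun q u y hq huy =>
    hwc.neighbor_of_degree_two tG cG leafless hhk hh hk hdeg hq huy
  have sG : ∀ a b, G.Adj a b → G.Adj b a := fun _ _ => Adj.symm
  have iG : ∀ a, ¬ G.Adj a a := fun _ => G.irrefl
  obtain ⟨u, y, huy, hqN⟩ := Finset.card_eq_two.1 ((G.card_neighborFinset_eq_degree q).trans hq2)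
  have hq : ∀ a, G.Adj q a ↔ a = u ∨ a = y := by
    intro a
    rw [← mem_neighborFinset, hqN]
    simp
  obtain ⟨x, hxq, hu⟩ := nb q u y hq huy
  obtain ⟨z, hzq, hy⟩ := nb q y u (fun a => (hq a).trans or_comm) huy.symm
  obtain ⟨z', hyz', hzx'⟩ := hwc.exists_common_neighbor tG cG leafless hhk hh
    (fun a => hq2 ▸ hdeg a) (((hu q).2 (.inl rfl))) ((hu x).2 (.inr rfl)) hxq
    ((hq y).2 (.inr rfl)) huy.symm
  have hzx : G.Adj z x := by
    rcases (hy z').1 hyz' with rfl | rfl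
    · exact absurd ((hu x).2 (.inr rfl)) fun hux => tG z' u x ((hq u).2 (.inl rfl)) hux hzx'.symm
    · exact hzx'
  clear hyz' hzx' z'
  obtain ⟨x', hx'u, hx⟩ := nb u x q (fun a => (hu a).trans or_comm) hxq
  obtain ⟨z', hz'y, hz⟩ := nb y z q (fun a => (hy a).trans or_comm) hzq
  have hxz' : x' = z := by grind
  have hzx' : z' = x := by grind
  subst hxz' hzx'
  have hall : ∀ a, a = q ∨ a = u ∨ a = z' ∨ a = x' ∨ a = y :=
    hG.mem_of_closed {a | a = q ∨ a = u ∨ a = z' ∨ a = x' ∨ a = y} (x := q) (.inl rfl) (by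
      simp only [Set.mem_ofPred_eq]
      rintro a (rfl | rfl | rfl | rfl | rfl) b hab
      · have := (hq b).1 hab; tauto
      · have := (hu b).1 hab; tauto
      · have := (hx b).1 hab; tauto
      · have := (hz b).1 hab; tauto
      · have := (hy b).1 hab; tauto)
  have d1 : q ≠ u := by grind
  have d2 : q ≠ y := by grind
  have d3 : u ≠ z' := by grind
  have d4 : u ≠ x' := by grind
  have d5 : z' ≠ x' := by grind
  have d6 : z' ≠ y := by grind
  have d7 : x' ≠ y := by grind
  let f : Fin 5 → V := ![q, u, z', x', y]
  have hf : Function.Bijective f := by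
    constructor
    · intro i j hij
      fin_cases i <;> fin_cases j <;> first | rfl | (simp [f] at hij; grind)
    · intro a
      rcases hall a with rfl | rfl | rfl | rfl | rfl
      exacts [⟨0, rfl⟩, ⟨1, rfl⟩, ⟨2, rfl⟩, ⟨3, rfl⟩, ⟨4, rfl⟩]
  refine ⟨(RelIso.mk (Equiv.ofBijective f hf) ?_ : cycleGraph 5 ≃g G).symm⟩
  intro i j
  change G.Adj (f i) (f j) ↔ _
  have e : (cycleGraph 5).Adj i j ↔ j = i + 1 ∨ i = j + 1 := by
    revert i j; decide
  rw [e]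
  fin_cases i <;> fin_cases j <;> simp [f, hq, hu, hx, hy, hz] <;> grind

/-- The leafless factor of a well-covered prism is a five-cycle; `H` is the edge `h k`. -/
theorem IsWellCovered.nonempty_iso_of_leafless [Finite V] [Finite W] (hG : G.Connected)
    (tG : ∀ a b c, G.Adj a b → G.Adj b c → ¬ G.Adj c a)
    (cG : ∀ a b c d, a ≠ c → b ≠ d → G.Adj a b → G.Adj b c → G.Adj c d → ¬ G.Adj d a)
    [Nontrivial V] (leafless : ∀ x y, G.Adj x y → ∃ z, z ≠ y ∧ G.Adj x z)
    {h k : W} (hhk : H.Adj h k) (hh : ∀ x, H.Adj h x → x = k) (hk : ∀ x, H.Adj k x → x = h)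
    (hwc : (G □ H).IsWellCovered) : Nonempty (G ≃g cycleGraph 5) := by
  classical
  have := Fintype.ofFinite V
  have hdeg : ∀ a, 2 ≤ G.degree a := by
    intro a
    obtain ⟨b, hab⟩ := hG.preconnected.exists_adj_of_nontrivial a
    obtain ⟨c, hcb, hac⟩ := leafless a b hab
    rw [← card_neighborFinset_eq_degree]
    exact Finset.one_lt_card.2 ⟨b, by simpa, c, by simpa, hcb.symm⟩
  obtain ⟨q, hq⟩ := Finite.exists_min fun a => G.degree a
  rcases (hdeg q).eq_or_lt with h2 | h3
  · exact hwc.nonempty_iso_cycleGraph_five hG tG cG leafless hhk hh hk hdeg h2.symm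
  · exact absurd hwc (not_isWellCovered_prism_of_three_le_degree tG cG leafless hhk hh hq h3)

end SimpleGraph

theorem mainTheorem1 {V W : Type*} [Finite V] [Finite W] [Nontrivial V] [Nontrivial W]
    (G : SimpleGraph V) (H : SimpleGraph W) (hG : G.Connected) (hH : H.Connected)
    (hGg : 5 ≤ G.egirth) (hHg : 5 ≤ H.egirth) :
    (G □ H).IsWellCovered ↔
      Nonempty ((G □ H) ≃g (SimpleGraph.completeGraph (Fin 2) □ SimpleGraph.completeGraph (Fin 2))) ∨
      Nonempty ((G □ H) ≃g (SimpleGraph.cycleGraph 5 □ SimpleGraph.completeGraph (Fin 2))) := by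
  constructor
  · intro hwc
    have tG := SimpleGraph.not_triangle_of_le_egirth hGg
    have tH := SimpleGraph.not_triangle_of_le_egirth hHg
    have cG := SimpleGraph.not_four_cycle_of_le_egirth hGg
    have cH := SimpleGraph.not_four_cycle_of_le_egirth hHg
    have eG : ∃ u v, G.Adj u v := ⟨_, hG.preconnected.exists_adj_of_nontrivial hG.nonempty.some⟩
    have eH : ∃ u v, H.Adj u v := ⟨_, hH.preconnected.exists_adj_of_nontrivial hH.nonempty.some⟩
    have hwc' := hwc.of_iso (SimpleGraph.boxProdComm H G)
    rcases hwc.edge_or_leafless tG tH eH with ⟨u, v, huv, hu, hv⟩ | lG <;>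
      rcases hwc'.edge_or_leafless tH tG eG with ⟨h, k, hhk, hh, hk⟩ | lH
    · obtain ⟨e⟩ := hG.nonempty_iso_completeGraph_two huv hu hv
      obtain ⟨f⟩ := hH.nonempty_iso_completeGraph_two hhk hh hk
      exact .inl ⟨SimpleGraph.boxProdIso e f⟩
    · obtain ⟨e⟩ := hG.nonempty_iso_completeGraph_two huv hu hv
      obtain ⟨f⟩ := hwc'.nonempty_iso_of_leafless hH tH cH lH huv hu hv
      exact .inr ⟨(SimpleGraph.boxProdComm G H).trans (SimpleGraph.boxProdIso f e)⟩
    · obtain ⟨e⟩ := hwc.nonempty_iso_of_leafless hG tG cG lG hhk hh hk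
      obtain ⟨f⟩ := hH.nonempty_iso_completeGraph_two hhk hh hk
      exact .inr ⟨SimpleGraph.boxProdIso e f⟩
    · exact absurd hwc (SimpleGraph.not_isWellCovered_boxProd_of_leafless tG cG tH lG lH eG eH)
  · rintro (⟨⟨e⟩⟩ | ⟨⟨e⟩⟩)
    · exact SimpleGraph.isWellCovered_completeGraph_two_boxProd.of_iso e
    · exact SimpleGraph.isWellCovered_cycleGraph_five_boxProd.of_iso e
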